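/- Let $n\ge 4$ and let $(V,Q)$ be an $n$-dimensional orthogonal space over $\mathbb F_3$, with associated bilinear form $(u,v)=Q(u+v)-Q(u)-Q(v)$, such that the Gram matrix of a basis of $V$ has determinant $-1$ (in particular the form is nondegenerate). For $v\in V$ with $Q(v)=1$ let $t(v)\colon w\mapsto w-(v,w)v$ be the reflection in $v$. Let $O_n^{-,+}(3)$ be the subgroup of the isometry group of $(V,Q)$ generated by all $t(v)$ with $Q(v)=1$, and let $PO_n^{-,+}(3)$ be its quotient by the scalar transformations contained in it. Let $G\cong PO_n^{-,+}(3)$, and let $D\subseteq G$ be the set corresponding under this isomorphism to the set of images of the reflections $t(v)$, $Q(v)=1$. Let $\varphi(G)$ denote the maximal number $k$ for which there is an injective homomorphism $S_k\to G$ mapping every transposition $(i\,j)$ into $D$. Then this maximum exists, and $$\varphi(G)=\begin{cases} n & \text{if } n\equiv 0 \pmod 3,\\ n+1 & \text{if } n\equiv 2 \pmod 3,\\ n+2 & \text{if } n\equiv 1 \pmod 3.\end{cases}$$ -/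

import Mathlib

namespace ThreeTransposition

variable {V : Type*} [AddCommGroup V] [Module (ZMod 3) V]

/-- `(V, Q)` is an `n`-dimensional orthogonal space over the field with three elements, and the
Gram matrix of some basis has determinant `μ = ±1`; in particular the form is nondegenerate.
The bilinear form is `(u, v) = Q (u + v) - Q u - Q v`, so that `(v, v) = 2 Q v = - Q v`. -/
def IsOrthogonalSpace (Q : QuadraticForm (ZMod 3) V) (n : ℕ) (μ : (ZMod 3)ˣ) : Prop :=
  ∃ b : Module.Basis (Fin n) (ZMod 3) V,
    (Matrix.of fun i j => QuadraticMap.polar Q (b i) (b j)).det = μ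

theorem reflection_aux (Q : QuadraticForm (ZMod 3) V) (v : V) (hv : Q v ≠ 0) :
    ((Q v)⁻¹ • QuadraticMap.polarBilin Q v) v = 2 := by
  have h : (Q v)⁻¹ * Q v = 1 := inv_mul_cancel₀ hv
  simp only [LinearMap.smul_apply, QuadraticMap.polarBilin_apply_apply, QuadraticMap.polar_self,
    smul_eq_mul, nsmul_eq_mul, Nat.cast_ofNat]
  linear_combination 2 * h

/-- The reflection `t(v) : w ↦ w - ((v, w) / Q v) v` in a nonsingular vector `v`
(that is, `w ↦ w - 2 ((w, v) / (v, v)) v`). -/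
noncomputable def orthReflection (Q : QuadraticForm (ZMod 3) V) (v : V) (hv : Q v ≠ 0) :
    V ≃ₗ[ZMod 3] V :=
  Module.reflection (reflection_aux Q v hv)

theorem orthReflection_apply (Q : QuadraticForm (ZMod 3) V) (v : V) (hv : Q v ≠ 0) (w : V) :
    orthReflection Q v hv w = w - ((Q v)⁻¹ * QuadraticMap.polar Q v w) • v := by
  simp [orthReflection, Module.reflection_apply]

/-- A reflection preserves `Q`, so it lies in the isometry group of `(V, Q)`. -/
theorem orthReflection_isometry (Q : QuadraticForm (ZMod 3) V) (v : V) (hv : Q v ≠ 0) (w : V) :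
    Q (orthReflection Q v hv w) = Q w := by
  have h : (Q v)⁻¹ * Q v = 1 := inv_mul_cancel₀ hv
  rw [orthReflection_apply, sub_eq_add_neg, ← neg_smul, QuadraticMap.map_add Q,
    QuadraticMap.map_smul, QuadraticMap.polar_smul_right, QuadraticMap.polar_comm Q w v]
  simp only [smul_eq_mul]
  linear_combination (QuadraticMap.polar Q v w) ^ 2 * (Q v)⁻¹ * h

/-- The set of reflections `t(v)` for the vectors `v` with `Q v = π`. -/
def reflections (Q : QuadraticForm (ZMod 3) V) (π : (ZMod 3)ˣ) : Set (V ≃ₗ[ZMod 3] V) :=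
  {g | ∃ (v : V) (hv : Q v ≠ 0), Q v = π ∧ g = orthReflection Q v hv}

/-- The group generated by the reflections `t(v)` with `Q v = π`.  When `(V, Q)` has dimension `n`
and discriminant `μ`, this is `O_n^{μ,π}(3)`. -/
def reflectionGroup (Q : QuadraticForm (ZMod 3) V) (π : (ZMod 3)ˣ) :
    Subgroup (V ≃ₗ[ZMod 3] V) :=
  Subgroup.closure (reflections Q π)

/-- The group of scalar transformations of `V`. -/
def scalars (V : Type*) [AddCommGroup V] [Module (ZMod 3) V] : Subgroup (V ≃ₗ[ZMod 3] V) where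
  carrier := {g | ∃ c : (ZMod 3)ˣ, ∀ v, g v = c • v}
  one_mem' := ⟨1, fun v => by simp⟩
  mul_mem' := by
    rintro f g ⟨a, ha⟩ ⟨b, hb⟩
    exact ⟨a * b, fun v => by rw [LinearEquiv.mul_apply, hb, ha, mul_smul]⟩
  inv_mem' := by
    rintro f ⟨a, ha⟩
    refine ⟨a⁻¹, fun v => f.injective ?_⟩
    rw [ha (a⁻¹ • v), smul_inv_smul]
    exact f.apply_symm_apply v

instance scalars_normal : (scalars V).Normal where
  conj_mem := by
    rintro f ⟨c, hc⟩ g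
    refine ⟨c, fun v => ?_⟩
    rw [LinearEquiv.mul_apply, LinearEquiv.mul_apply, hc, Units.smul_def, map_smul]
    congr 1
    exact g.apply_symm_apply v

/-- The projective group: `reflectionGroup Q π` modulo the scalar transformations in it.
When `(V, Q)` has dimension `n` and discriminant `μ`, this is `PO_n^{μ,π}(3)`. -/
abbrev ProjReflectionGroup (Q : QuadraticForm (ZMod 3) V) (π : (ZMod 3)ˣ) : Type _ :=
  reflectionGroup Q π ⧸ (scalars V).subgroupOf (reflectionGroup Q π)

/-- The class `D` of transpositions of the projective group: the images of the reflections `t(v)`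
with `Q v = π`. -/
def projReflections (Q : QuadraticForm (ZMod 3) V) (π : (ZMod 3)ˣ) :
    Set (ProjReflectionGroup Q π) :=
  {x | ∃ g : reflectionGroup Q π, (g : V ≃ₗ[ZMod 3] V) ∈ reflections Q π ∧ x = QuotientGroup.mk g}

/-- The set of those `k` for which there is a monomorphism `S_k → G` that maps every transposition
`(i j)` into `D`.  The number `φ(G)` is the greatest element of this set. -/
def symmetricDegrees {G : Type*} [Group G] (D : Set G) : Set ℕ :=
  {k | ∃ f : Equiv.Perm (Fin k) →* G, Function.Injective f ∧
    ∀ i j : Fin k, i ≠ j → f (Equiv.swap i j) ∈ D}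

end ThreeTransposition

namespace ThreeTransposition

open QuadraticMap

/-! ### Gram determinants, discriminant and diagonalisation -/

section Gram

variable {V : Type*} [AddCommGroup V] [Module (ZMod 3) V]

/-! The answer in all three cases is the multiple of 3 among `n`, `n + 1`, `n + 2`; call it `m`.

Upper bound: if `k > m`, take `m` transpositions sharing a letter. They are images of reflections in
vectors `v i` of norm `Q = 1`, pairwise non-orthogonal because the transpositions do not commute.
Since `(p i p j)` commutes with `(o p l)`, the reflected vector `v j - (v i, v j) v i` is orthogonal
to `v l`, so the signs `(v i, v j)` multiply along triangles. After sign changes the Gram matrix is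
`1 + J`, of determinant `1 + m = 1`. The `m` vectors are then independent, so `m = n`, and the
discriminant `-1` would have to be a square in `𝔽₃`.

Lower bound: `S_m` acts through vectors `u i` with `(u i, u j) = δ_ij + a i + a j`. The offsets `a`
cancel in differences, so the `u i - u j` pair like roots of type A and their reflections act like
transpositions. `exists_isRootFrame` builds such a family from a diagonal basis with norms `1, …, 1,
-1`, and five members are enough for faithfulness modulo scalars. -/

/-- The Gram matrix of a family of vectors with respect to the polar form. -/
def gram {ι : Type*} (Q : QuadraticForm (ZMod 3) V) (v : ι → V) : Matrix ι ι (ZMod 3) :=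
  Matrix.of fun i j => polar Q (v i) (v j)

theorem polar_sum_right {ι : Type*} (Q : QuadraticForm (ZMod 3) V) (s : Finset ι) (x : V)
    (v : ι → V) : polar Q x (∑ i ∈ s, v i) = ∑ i ∈ s, polar Q x (v i) := by
  simpa only [polarBilin_apply_apply] using map_sum (polarBilin Q x) v s

theorem polar_sum_left {ι : Type*} (Q : QuadraticForm (ZMod 3) V) (s : Finset ι) (x : V)
    (v : ι → V) : polar Q (∑ i ∈ s, v i) x = ∑ i ∈ s, polar Q (v i) x := by
  simp only [polar_comm Q _ x, polar_sum_right]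

theorem polar_self_eq (Q : QuadraticForm (ZMod 3) V) (v : V) : polar Q v v = 2 * Q v := by
  simp [polar_self]

theorem eq_one_of_polar_self (Q : QuadraticForm (ZMod 3) V) (v : V) (h : polar Q v v = 2) :
    Q v = 1 := by
  rw [polar_self_eq] at h
  generalize Q v = q at h
  revert q
  decide

theorem gram_eq_mul {ι κ : Type*} [Fintype κ] (Q : QuadraticForm (ZMod 3) V)
    (b : Module.Basis κ (ZMod 3) V) (v : ι → V) :
    gram Q v = (Matrix.of fun i j => b.repr (v i) j) *
      (gram Q b * (Matrix.of fun i j => b.repr (v i) j).transpose) := by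
  ext i j
  have h : polar Q (v i) (v j) =
      polar Q (∑ k, b.repr (v i) k • b k) (∑ k, b.repr (v j) k • b k) := by
    rw [b.sum_repr, b.sum_repr]
  simp only [gram, Matrix.mul_apply, Matrix.of_apply, Matrix.transpose_apply]
  rw [h, polar_sum_left]
  refine Finset.sum_congr rfl fun k _ => ?_
  rw [polar_sum_right, Finset.mul_sum]
  refine Finset.sum_congr rfl fun l _ => ?_
  rw [polar_smul_left, polar_smul_right, smul_eq_mul, smul_eq_mul]
  ring

/-- The discriminant is an invariant modulo squares; `p` is the determinant of the coordinate
matrix, zero when `v` is dependent. -/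
theorem exists_det_gram {n : ℕ} (Q : QuadraticForm (ZMod 3) V)
    (b : Module.Basis (Fin n) (ZMod 3) V) (v : Fin n → V) :
    ∃ p : ZMod 3, (gram Q v).det = p * p * (gram Q b).det := by
  refine ⟨(Matrix.of fun i j => b.repr (v i) j).det, ?_⟩
  rw [gram_eq_mul Q b v, Matrix.det_mul, Matrix.det_mul, Matrix.det_transpose]
  ring

/-- A family of `m` vectors whose Gram matrix is `1 + J`, with `3 ∣ m`, does not exist in an
orthogonal space of discriminant `-1` and dimension at most `m`. -/
theorem not_gram_one_add_one {n m : ℕ} {Q : QuadraticForm (ZMod 3) V}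
    (hQ : IsOrthogonalSpace Q n (-1)) (hm : m % 3 = 0) (hnm : n ≤ m) (v : Fin m → V)
    (hv : ∀ i j, polar Q (v i) (v j) = if i = j then 2 else 1) : False := by
  obtain ⟨b, hb⟩ := hQ
  have hb' : (gram Q b).det = -1 := by simpa [gram] using hb
  have hdet : (gram Q v).det = 1 := by
    have h1 : gram Q v = 1 + Matrix.replicateCol Unit (fun _ : Fin m => (1 : ZMod 3)) *
        Matrix.replicateRow Unit (fun _ : Fin m => (1 : ZMod 3)) := by
      ext i j
      by_cases hij : i = j
      · simp [gram, hv, hij, Matrix.mul_apply]; norm_num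
      · simp [gram, hv, hij, Matrix.mul_apply]
    -- A rank-one update of the identity: the determinant is `1 + m`, and `m = 0` in `𝔽₃`.
    rw [h1, Matrix.det_one_add_replicateCol_mul_replicateRow]
    simp [dotProduct, (ZMod.natCast_eq_zero_iff m 3).2 (Nat.dvd_of_mod_eq_zero hm)]
  rcases hnm.lt_or_eq with h | rfl
  -- A Gram matrix of vectors in dimension `n` has rank at most `n`, which rules out `n < m`; for `n
  -- = m` the equation `1 = -p²` has no solution.
  · have hr : (gram Q v).rank = m := by
      rw [Matrix.rank_of_isUnit _ ((Matrix.isUnit_iff_isUnit_det _).2 (by simp [hdet])),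
        Fintype.card_fin]
    have hr' : (gram Q v).rank ≤ n := by
      rw [gram_eq_mul Q b v]
      exact (Matrix.rank_mul_le_left _ _).trans
        ((Matrix.rank_le_card_width _).trans_eq (Fintype.card_fin n))
    omega
  · obtain ⟨p, hp⟩ := exists_det_gram Q b v
    rw [hdet, hb'] at hp
    revert p
    decide

theorem exists_orthogonal_family {n : ℕ} {Q : QuadraticForm (ZMod 3) V}
    (hQ : IsOrthogonalSpace Q n (-1)) :
    ∃ v : Fin n → V, (∀ i j, i ≠ j → polar Q (v i) (v j) = 0) ∧
      ∀ i, polar Q (v i) (v i) ≠ 0 := by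
  obtain ⟨b, hb⟩ := hQ
  have hb' : (gram Q b).det = -1 := by simpa [gram] using hb
  have : Module.Finite (ZMod 3) V := Module.Finite.of_basis b
  have : Invertible (2 : ZMod 3) := ⟨2, by decide, by decide⟩
  have hsymm : (polarBilin Q).IsSymm :=
    ⟨fun x y => by simp [polarBilin_apply_apply, polar_comm Q x y]⟩
  have hex := LinearMap.BilinForm.exists_orthogonal_basis (B := polarBilin Q) hsymm
  rw [Module.finrank_eq_card_basis b, Fintype.card_fin] at hex
  obtain ⟨v, hv⟩ := hex
  have hort : ∀ i j, i ≠ j → polar Q (v i) (v j) = 0 := fun i j hij => hv hij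
  refine ⟨v, hort, fun i hi => ?_⟩
  obtain ⟨p, hp⟩ := exists_det_gram Q v b
  have hz : (gram Q v).det = 0 := by
    refine Matrix.det_eq_zero_of_row_eq_zero i fun j => ?_
    by_cases hij : i = j
    · subst hij; exact hi
    · exact hort i j hij
  rw [hz, hb', mul_zero] at hp
  revert hp
  decide

/-- Two orthogonal vectors of norm `-1` can be replaced by two orthogonal vectors of norm `1`
with the same span, so all but one of the norms may be taken to be `1`. -/
theorem exists_orthogonal_family_card_le {n : ℕ} {Q : QuadraticForm (ZMod 3) V} :
    ∀ (c : ℕ) (v : Fin n → V), (∀ i j, i ≠ j → polar Q (v i) (v j) = 0) →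
      (∀ i, polar Q (v i) (v i) ≠ 0) →
      (Finset.univ.filter fun i => polar Q (v i) (v i) = -1).card ≤ c →
      ∃ w : Fin n → V, (∀ i j, i ≠ j → polar Q (w i) (w j) = 0) ∧
        (∀ i, polar Q (w i) (w i) ≠ 0) ∧
        (Finset.univ.filter fun i => polar Q (w i) (w i) = -1).card ≤ 1 := by
  intro c
  induction c with
  | zero => exact fun v h1 h2 h3 => ⟨v, h1, h2, h3.trans zero_le_one⟩
  | succ c ih =>
    intro v h1 h2 h3
    by_cases h : (Finset.univ.filter fun i => polar Q (v i) (v i) = -1).card ≤ 1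
    · exact ⟨v, h1, h2, h⟩
    obtain ⟨i, hi, j, hj, hij⟩ := Finset.one_lt_card.1 (not_le.1 h)
    have hi' := (Finset.mem_filter.1 hi).2
    have hj' := (Finset.mem_filter.1 hj).2
    -- The sum and the difference both have norm `-1 + -1 = 1` in `𝔽₃`.
    set w : Fin n → V := fun l => if l = i then v i + v j else if l = j then v i - v j else v l
      with hw
    have wi : w i = v i + v j := by simp [hw]
    have wj : w j = v i - v j := by simp [hw, hij.symm]
    have wl : ∀ l, l ≠ i → l ≠ j → w l = v l := fun l ha hb => by simp [hw, ha, hb]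
    have hij0 := h1 i j hij
    have hji0 := h1 j i hij.symm
    have nwi : polar Q (w i) (w i) = 1 := by
      rw [wi]
      simp only [polar_add_left, polar_add_right, hi', hj', hij0, hji0]
      decide
    have nwj : polar Q (w j) (w j) = 1 := by
      rw [wj]
      simp only [polar_sub_left, polar_sub_right, hi', hj', hij0, hji0]
      decide
    have oij : polar Q (w i) (w j) = 0 := by
      rw [wi, wj]
      simp only [polar_add_left, polar_sub_right, hi', hj', hij0, hji0]
      decide
    have oil : ∀ l, l ≠ i → l ≠ j → polar Q (w i) (w l) = 0 := fun l ha hb => by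
      rw [wi, wl l ha hb, polar_add_left, h1 i l ha.symm, h1 j l hb.symm, add_zero]
    have ojl : ∀ l, l ≠ i → l ≠ j → polar Q (w j) (w l) = 0 := fun l ha hb => by
      rw [wj, wl l ha hb, polar_sub_left, h1 i l ha.symm, h1 j l hb.symm, sub_zero]
    refine ih w ?_ ?_ ?_
    · intro k l hkl
      by_cases hki : k = i
      · subst hki
        by_cases hlj : l = j
        · rw [hlj, oij]
        · exact oil l hkl.symm hlj
      by_cases hkj : k = j
      · subst hkj
        by_cases hli : l = i
        · rw [hli, polar_comm, oij]
        · exact ojl l hli hkl.symm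
      by_cases hli : l = i
      · rw [hli, polar_comm, oil k hki hkj]
      by_cases hlj : l = j
      · rw [hlj, polar_comm, ojl k hki hkj]
      rw [wl k hki hkj, wl l hli hlj, h1 k l hkl]
    · intro k
      by_cases hki : k = i
      · rw [hki, nwi]; decide
      by_cases hkj : k = j
      · rw [hkj, nwj]; decide
      rw [wl k hki hkj]
      exact h2 k
    · refine Nat.le_of_lt_succ (lt_of_lt_of_le (Finset.card_lt_card ?_) h3)
      refine (Finset.ssubset_iff_of_subset ?_).2 ⟨i, hi, ?_⟩
      · intro k hk
        have hk' := (Finset.mem_filter.1 hk).2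
        have hki : k ≠ i := by
          rintro rfl
          rw [nwi] at hk'
          exact absurd hk' (by decide)
        have hkj : k ≠ j := by
          rintro rfl
          rw [nwj] at hk'
          exact absurd hk' (by decide)
        rw [wl k hki hkj] at hk'
        exact Finset.mem_filter.2 ⟨Finset.mem_univ k, hk'⟩
      · intro hmem
        have hk' := (Finset.mem_filter.1 hmem).2
        rw [nwi] at hk'
        exact absurd hk' (by decide)

/-- Pairing off norms `-1` leaves at most one; none at all would give discriminant `1`, which
differs from `-1` by a nonsquare. -/
theorem exists_orthogonal_frame {n : ℕ} {Q : QuadraticForm (ZMod 3) V}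
    (hQ : IsOrthogonalSpace Q n (-1)) :
    ∃ (v : Fin n → V) (i₀ : Fin n), ∀ i j,
      polar Q (v i) (v j) = if i = j then (if i = i₀ then -1 else 1) else 0 := by
  obtain ⟨v₀, h1, h2⟩ := exists_orthogonal_family hQ
  obtain ⟨v, h1, h2, h3⟩ := exists_orthogonal_family_card_le _ v₀ h1 h2 le_rfl
  have key : ∀ x : ZMod 3, x ≠ 0 → x ≠ -1 → x = 1 := by decide
  have hne : (Finset.univ.filter fun i => polar Q (v i) (v i) = -1).Nonempty := by
    rw [Finset.nonempty_iff_ne_empty]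
    intro hemp
    have hone : ∀ i, polar Q (v i) (v i) = 1 := fun i =>
      key _ (h2 i) fun hi => by
        have hmem : i ∈ Finset.univ.filter fun i => polar Q (v i) (v i) = -1 :=
          Finset.mem_filter.2 ⟨Finset.mem_univ i, hi⟩
        rw [hemp] at hmem
        exact absurd hmem (Finset.notMem_empty i)
    have hg : gram Q v = 1 := by
      ext i j
      by_cases hij : i = j
      · subst hij; simp [gram, hone]
      · simp [gram, hij, h1 i j hij]
    obtain ⟨b, hb⟩ := hQ
    have hb' : (gram Q b).det = -1 := by simpa [gram] using hb
    obtain ⟨p, hp⟩ := exists_det_gram Q b v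
    rw [hg, hb', Matrix.det_one] at hp
    revert p
    decide
  obtain ⟨i₀, hi₀⟩ := hne
  refine ⟨v, i₀, fun i j => ?_⟩
  by_cases hij : i = j
  · subst hij
    by_cases hi : i = i₀
    · subst hi; simpa using (Finset.mem_filter.1 hi₀).2
    · rw [if_pos rfl, if_neg hi]
      refine key _ (h2 i) fun h => hi ?_
      exact Finset.card_le_one.1 h3 i (Finset.mem_filter.2 ⟨Finset.mem_univ i, h⟩) i₀ hi₀
  · rw [if_neg hij, h1 i j hij]

end Gram

/-! ### Commutation and conjugation of reflections -/

section Reflection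

variable {V : Type*} [AddCommGroup V] [Module (ZMod 3) V] {Q : QuadraticForm (ZMod 3) V}

theorem orthReflection_apply_of_eq_one {v : V} (hv : Q v ≠ 0) (h1 : Q v = 1) (w : V) :
    orthReflection Q v hv w = w - polar Q v w • v := by
  rw [orthReflection_apply, h1, inv_one, one_mul]

/-- Conjugating a reflection by a reflection gives the reflection in the image vector. -/
theorem orthReflection_conj {u v : V} (hu : Q u ≠ 0) (hv : Q v ≠ 0)
    (h : Q (orthReflection Q u hu v) ≠ 0) :
    orthReflection Q (orthReflection Q u hu v) h =
      orthReflection Q u hu * orthReflection Q v hv * orthReflection Q u hu := by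
  have hinv : ∀ x, orthReflection Q u hu (orthReflection Q u hu x) = x :=
    Module.involutive_reflection (reflection_aux Q u hu)
  have hpol : ∀ x y, polar Q (orthReflection Q u hu x) (orthReflection Q u hu y) =
      polar Q x y := fun x y => by
    simp only [polar, ← map_add, orthReflection_isometry]
  ext w
  rw [LinearEquiv.mul_apply, LinearEquiv.mul_apply, orthReflection_apply, orthReflection_isometry]
  rw [orthReflection_apply Q v hv, map_sub, map_smul, hinv]
  rw [← hpol v (orthReflection Q u hu w), hinv]

theorem orthReflection_commute {u v : V} (hu : Q u ≠ 0) (hv : Q v ≠ 0) (h : polar Q u v = 0) :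
    orthReflection Q u hu * orthReflection Q v hv =
      orthReflection Q v hv * orthReflection Q u hu := by
  ext w
  have h' : polar Q v u = 0 := by rw [polar_comm, h]
  simp only [LinearEquiv.mul_apply, orthReflection_apply, polar_sub_right, polar_smul_right, h, h',
    smul_zero, sub_zero]
  abel

/-- Reflections that commute up to a scalar belong to vectors that are orthogonal or equal up to
sign. -/
theorem polar_eq_zero_of_commute_scalar [Module.Finite (ZMod 3) V]
    (hdim : 3 ≤ Module.finrank (ZMod 3) V) {u v : V} (hu : Q u ≠ 0) (hv : Q v ≠ 0)
    (hu1 : Q u = 1) (hv1 : Q v = 1) (c : (ZMod 3)ˣ)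
    (h : ∀ x, orthReflection Q u hu (orthReflection Q v hv x) =
      c • orthReflection Q v hv (orthReflection Q u hu x)) :
    polar Q u v = 0 ∨ u = v ∨ u = -v := by
  simp only [orthReflection_apply_of_eq_one hu hu1, orthReflection_apply_of_eq_one hv hv1] at h
  -- In dimension at least 3 some nonzero `x` is orthogonal to both `u` and `v`; both reflections
  -- fix it, so the scalar is `1`.
  have hc : c = 1 := by
    let L : V →ₗ[ZMod 3] (Fin 2 → ZMod 3) := LinearMap.pi ![polarBilin Q u, polarBilin Q v]
    have hlt : Module.finrank (ZMod 3) (Fin 2 → ZMod 3) < Module.finrank (ZMod 3) V := by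
      rw [Module.finrank_fin_fun]; omega
    obtain ⟨x, hx, hx0⟩ :=
      Submodule.exists_mem_ne_zero_of_ne_bot (LinearMap.ker_ne_bot_of_finrank_lt hlt (f := L))
    have hxu : polar Q u x = 0 := by simpa [L] using congrFun (LinearMap.mem_ker.1 hx) 0
    have hxv : polar Q v x = 0 := by simpa [L] using congrFun (LinearMap.mem_ker.1 hx) 1
    have hcx := h x
    simp only [hxu, hxv, zero_smul, sub_zero] at hcx
    have : ((c : ZMod 3) - 1) • x = 0 := by
      rw [sub_smul, one_smul, sub_eq_zero]; exact hcx.symm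
    rcases smul_eq_zero.1 this with h0 | h0
    · exact Units.ext (by simpa using sub_eq_zero.1 h0)
    · exact absurd h0 hx0
  subst hc
  -- Comparing both products at `v` suffices: with `β = (u, v)` it yields `2β u = β² v`.
  have hself : polar Q v v = 2 := by rw [polar_self_eq, hv1, mul_one]
  have hx := h v
  rw [one_smul] at hx
  simp only [hself, polar_sub_right, polar_smul_right, smul_eq_mul, polar_comm Q v u] at hx
  generalize polar Q u v = β at hx
  have hx' : (2 * β) • u = (β * β) • v := by
    linear_combination (norm := module) hx
  have h3 : ∀ β : ZMod 3, β = 0 ∨ β = 1 ∨ β = -1 := by decide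
  rcases h3 β with rfl | rfl | rfl
  · exact Or.inl rfl
  · right; right
    have : (-1 : ZMod 3) • u = (1 : ZMod 3) • v := hx'
    rw [neg_smul, one_smul, one_smul] at this
    rw [← this, neg_neg]
  · right; left
    have : (1 : ZMod 3) • u = (1 : ZMod 3) • v := hx'
    simpa using this

end Reflection

/-! ### Upper bound: a star of transpositions -/

section Upper

variable {V : Type*} [AddCommGroup V] [Module (ZMod 3) V] {Q : QuadraticForm (ZMod 3) V}

/-- Membership in `projReflections Q 1`, in terms of vectors. -/
theorem exists_vector_of_mem_projReflections {x : ProjReflectionGroup Q 1}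
    (hx : x ∈ projReflections Q 1) :
    ∃ (v : V) (hv : Q v ≠ 0) (g : reflectionGroup Q 1),
      Q v = 1 ∧ (g : V ≃ₗ[ZMod 3] V) = orthReflection Q v hv ∧ x = QuotientGroup.mk g := by
  obtain ⟨g, ⟨v, hv, hv1, hg⟩, hxg⟩ := hx
  exact ⟨v, hv, g, by simpa using hv1, hg, hxg⟩

theorem mk_eq_mk_iff_exists_unit (g h : reflectionGroup Q 1) :
    (QuotientGroup.mk g : ProjReflectionGroup Q 1) = QuotientGroup.mk h ↔
      ∃ c : (ZMod 3)ˣ, ∀ x, (h : V ≃ₗ[ZMod 3] V) x = c • (g : V ≃ₗ[ZMod 3] V) x := by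
  rw [QuotientGroup.eq, Subgroup.mem_subgroupOf]
  constructor
  · rintro ⟨c, hc⟩
    refine ⟨c, fun x => ?_⟩
    have := congrArg (g : V ≃ₗ[ZMod 3] V) (hc x)
    rw [Units.smul_def, map_smul] at this
    rw [Units.smul_def, ← this, ← LinearEquiv.mul_apply]
    congr 1
    simp
  · rintro ⟨c, hc⟩
    refine ⟨c, fun x => (g : V ≃ₗ[ZMod 3] V).injective ?_⟩
    rw [Units.smul_def, map_smul, ← Units.smul_def, ← hc, ← LinearEquiv.mul_apply]
    congr 1
    simp

theorem orthReflection_neg {u v : V} (hu : Q u ≠ 0) (hv : Q v ≠ 0) (h : u = v ∨ u = -v) :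
    orthReflection Q u hu = orthReflection Q v hv := by
  ext w
  rcases h with rfl | rfl
  · rfl
  · simp [orthReflection_apply]

/-- The symmetric group of degree `k ≥ m + 1` does not embed when `3 ∣ m` and `m ≥ n`. -/
theorem le_of_mem_symmetricDegrees {n m k : ℕ} (hn : 3 ≤ n) (hQ : IsOrthogonalSpace Q n (-1))
    (hm : m % 3 = 0) (hnm : n ≤ m) (hk : k ∈ symmetricDegrees (projReflections Q 1)) :
    k ≤ m := by
  by_contra! hmk
  obtain ⟨f, hf, hfD⟩ := hk
  have hdim : 3 ≤ Module.finrank (ZMod 3) V := by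
    obtain ⟨b, -⟩ := hQ
    rwa [Module.finrank_eq_card_basis b, Fintype.card_fin]
  have : Module.Finite (ZMod 3) V := Module.finite_of_finrank_pos (by omega)
  -- The common letter `o` and `m` further letters; the shift by one keeps `p` away from `o`.
  let o : Fin k := ⟨0, by omega⟩
  let p : Fin m → Fin k := fun i => ⟨i + 1, by omega⟩
  have hpo : ∀ i, o ≠ p i := fun i h => by simp [o, p] at h
  have hp : ∀ i j, i ≠ j → p i ≠ p j := fun i j hij h => hij (Fin.ext (by simpa [p] using h))
  choose v hv g hv1 hg hfg using fun i =>
    exists_vector_of_mem_projReflections (hfD o (p i) (hpo i))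
  -- distinct vectors are not orthogonal, since the transpositions do not commute
  have hne : ∀ i j, i ≠ j → polar Q (v i) (v j) ≠ 0 := by
    intro i j hij h0
    have hgg : g i * g j = g j * g i := Subtype.ext (by
      rw [Subgroup.coe_mul, Subgroup.coe_mul, hg, hg]
      exact orthReflection_commute (hv i) (hv j) h0)
    have hff : f (Equiv.swap o (p i) * Equiv.swap o (p j)) =
        f (Equiv.swap o (p j) * Equiv.swap o (p i)) := by
      rw [map_mul, map_mul, hfg, hfg, ← QuotientGroup.mk_mul, ← QuotientGroup.mk_mul, hgg]
    have := congrArg (fun σ : Equiv.Perm (Fin k) => σ o) (hf hff)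
    simp only [Equiv.Perm.mul_apply, Equiv.swap_apply_left] at this
    rw [Equiv.swap_apply_of_ne_of_ne (hpo j).symm (hp j i hij.symm),
      Equiv.swap_apply_of_ne_of_ne (hpo i).symm (hp i j hij)] at this
    exact hp i j hij this.symm
  -- the reflection of `v j` in `v i` corresponds to a transposition commuting with the one of `v l`
  have htri : ∀ i j l, i ≠ j → i ≠ l → j ≠ l →
      polar Q (v j) (v l) = polar Q (v i) (v j) * polar Q (v i) (v l) := by
    intro i j l hij hil hjl
    have hw1 : Q (orthReflection Q (v i) (hv i) (v j)) = 1 := by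
      rw [orthReflection_isometry, hv1]
    have hw : Q (orthReflection Q (v i) (hv i) (v j)) ≠ 0 := by rw [hw1]; decide
    have hgw : ((g i * g j * g i : reflectionGroup Q 1) : V ≃ₗ[ZMod 3] V) =
        orthReflection Q (orthReflection Q (v i) (hv i) (v j)) hw := by
      rw [orthReflection_conj (hv i) (hv j) hw, Subgroup.coe_mul, Subgroup.coe_mul, hg, hg]
    have hfw : f (Equiv.swap (p i) (p j)) = QuotientGroup.mk (g i * g j * g i) := by
      have hs : Equiv.swap (p i) (p j) =
          Equiv.swap o (p i) * Equiv.swap o (p j) * Equiv.swap o (p i) := by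
        rw [Equiv.swap_comm o (p j),
          Equiv.swap_mul_swap_mul_swap (hpo j).symm (hp j i hij.symm)]
      rw [hs, map_mul, map_mul, hfg, hfg, QuotientGroup.mk_mul, QuotientGroup.mk_mul]
    have hcomm : f (Equiv.swap o (p l)) * f (Equiv.swap (p i) (p j)) =
        f (Equiv.swap (p i) (p j)) * f (Equiv.swap o (p l)) := by
      rw [← map_mul, ← map_mul]
      congr 1
      refine (Equiv.Perm.Disjoint.commute fun x => ?_).eq
      by_cases h1 : x = o
      · right
        rw [h1, Equiv.swap_apply_of_ne_of_ne (hpo i) (hpo j)]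
      by_cases h2 : x = p l
      · right
        rw [h2, Equiv.swap_apply_of_ne_of_ne (hp l i hil.symm) (hp l j hjl.symm)]
      · exact Or.inl (Equiv.swap_apply_of_ne_of_ne h1 h2)
    rw [hfw, hfg, ← QuotientGroup.mk_mul, ← QuotientGroup.mk_mul, mk_eq_mk_iff_exists_unit] at hcomm
    obtain ⟨c, hc⟩ := hcomm
    simp only [Subgroup.coe_mul (_ : Subgroup _) (g i * g j * g i),
      Subgroup.coe_mul (_ : Subgroup _) (g l), hgw, hg, LinearEquiv.mul_apply] at hc
    rcases polar_eq_zero_of_commute_scalar hdim hw (hv l) hw1 (hv1 l) c hc with h | h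
    · rw [orthReflection_apply_of_eq_one _ (hv1 i), polar_sub_left, polar_smul_left,
        sub_eq_zero, smul_eq_mul] at h
      exact h
    -- Equal up to sign, the vectors would give the same reflection, making two distinct
    -- transpositions coincide.
    · have he : g i * g j * g i = g l :=
        Subtype.ext (by rw [hgw, hg, orthReflection_neg hw (hv l) h])
      rw [he, ← hfg] at hfw
      have := congrArg (fun σ : Equiv.Perm (Fin k) => σ o) (hf hfw)
      simp only [Equiv.swap_apply_left] at this
      rw [Equiv.swap_apply_of_ne_of_ne (hpo i) (hpo j)] at this
      exact absurd this (hpo l)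
  -- rescale so that all inner products with the first vector are `1`
  let z : Fin m := ⟨0, by omega⟩
  have h3 : ∀ x : ZMod 3, x ≠ 0 → x * x = 1 := by decide
  have hself : ∀ i, polar Q (v i) (v i) = 2 := fun i => by rw [polar_self_eq, hv1, mul_one]
  refine not_gram_one_add_one hQ hm hnm
    (fun i => (if i = z then 1 else polar Q (v z) (v i)) • v i) fun i j => ?_
  rw [polar_smul_left, polar_smul_right, smul_eq_mul, smul_eq_mul]
  by_cases hij : i = j
  · subst hij
    rw [if_pos rfl, hself, ← mul_assoc]
    by_cases hi : i = z
    · simp [hi]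
    · rw [if_neg hi, h3 _ (hne z i (Ne.symm hi)), one_mul]
  · rw [if_neg hij]
    by_cases hi : i = z
    · subst hi
      rw [if_pos rfl, if_neg (Ne.symm hij), one_mul, h3 _ (hne _ _ hij)]
    by_cases hj : j = z
    · subst hj
      rw [if_pos rfl, if_neg hi, one_mul, polar_comm Q (v i), h3 _ (hne _ _ (Ne.symm hij))]
    · rw [if_neg hi, if_neg hj, htri z i j (Ne.symm hi) (Ne.symm hj) hij]
      have h1 := h3 _ (hne z i (Ne.symm hi))
      have h2 := h3 _ (hne z j (Ne.symm hj))
      generalize polar Q (v z) (v i) = x at *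
      generalize polar Q (v z) (v j) = y at *
      linear_combination (y * y) * h1 + h2

end Upper

/-! ### Lower bound: symmetric groups from root frames -/

section Lower

variable {V : Type*} [AddCommGroup V] [Module (ZMod 3) V] {Q : QuadraticForm (ZMod 3) V}
variable {ι : Type*} [Fintype ι]

/-- A family of vectors of sum zero whose differences have the inner products of the roots
`e i - e j`. -/
structure IsRootFrame [DecidableEq ι] (Q : QuadraticForm (ZMod 3) V) (u : ι → V) (a : ι → ZMod 3) : Prop where
  polar_eq : ∀ i j, polar Q (u i) (u j) = (if i = j then 1 else 0) + a i + a j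
  sum_eq_zero : ∑ i, u i = 0

/-- The linear map by which a permutation of a root frame acts. -/
def permMap (Q : QuadraticForm (ZMod 3) V) (u : ι → V) (σ : Equiv.Perm ι) : V →ₗ[ZMod 3] V :=
  LinearMap.id + ∑ i, (polarBilin Q (u i)).smulRight (u (σ i) - u i)

theorem permMap_apply (u : ι → V) (σ : Equiv.Perm ι) (w : V) :
    permMap Q u σ w = w + ∑ i, polar Q (u i) w • (u (σ i) - u i) := by
  simp [permMap, LinearMap.sum_apply]

namespace IsRootFrame

variable {u : ι → V} {a : ι → ZMod 3}

theorem permMap_one (w : V) : permMap Q u 1 w = w := by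
  simp [permMap_apply]

variable [DecidableEq ι]

theorem polar_sub_sub (h : IsRootFrame Q u a) (p q i j : ι) :
    polar Q (u p - u q) (u i - u j) = (if p = i then 1 else 0) - (if p = j then 1 else 0)
      - (if q = i then 1 else 0) + (if q = j then 1 else 0) := by
  simp only [polar_sub_left, polar_sub_right, h.polar_eq]
  ring

/-- The coefficient of `u (σ p) - u p` is the expected Kronecker part plus `a i - a j`, independent
of `p`; the latter contributes nothing because the total displacement under a permutation is zero.
-/
theorem permMap_sub (h : IsRootFrame Q u a) (σ : Equiv.Perm ι) (i j : ι) :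
    permMap Q u σ (u i - u j) = u (σ i) - u (σ j) := by
  have hc : ∀ p, polar Q (u p) (u i - u j) =
      (if p = i then 1 else 0) - (if p = j then 1 else 0) + (a i - a j) := fun p => by
    rw [polar_sub_right, h.polar_eq, h.polar_eq]; ring
  rw [permMap_apply]
  simp only [hc, add_smul, sub_smul, Finset.sum_add_distrib, Finset.sum_sub_distrib, ite_smul,
    one_smul, zero_smul, Finset.sum_ite_eq', Finset.mem_univ, if_true]
  simp only [← Finset.smul_sum, Finset.sum_sub_distrib, Equiv.sum_comp σ u, h.sum_eq_zero,
    sub_self, smul_zero]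
  abel

/-- Displacements telescope: `u (σ (τ i)) - u (τ i)` plus `u (τ i) - u i`. -/
theorem permMap_mul (h : IsRootFrame Q u a) (σ τ : Equiv.Perm ι) (w : V) :
    permMap Q u (σ * τ) w = permMap Q u σ (permMap Q u τ w) := by
  rw [permMap_apply u τ w, map_add, map_sum]
  simp only [map_smul, h.permMap_sub]
  rw [permMap_apply, permMap_apply, add_assoc, ← Finset.sum_add_distrib]
  congr 1
  refine Finset.sum_congr rfl fun i _ => ?_
  rw [← smul_add, Equiv.Perm.mul_apply]
  congr 1
  abel

/-- The symmetric group acts linearly on the space of a root frame. -/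
def permHom (h : IsRootFrame Q u a) : Equiv.Perm ι →* (V ≃ₗ[ZMod 3] V) where
  toFun σ := LinearEquiv.ofLinearMap (permMap Q u σ) (permMap Q u σ⁻¹)
    (LinearMap.ext fun w => by
      rw [LinearMap.comp_apply, ← h.permMap_mul, mul_inv_cancel, permMap_one, LinearMap.id_apply])
    (LinearMap.ext fun w => by
      rw [LinearMap.comp_apply, ← h.permMap_mul, inv_mul_cancel, permMap_one, LinearMap.id_apply])
  map_one' := by
    ext w
    exact permMap_one w
  map_mul' σ τ := by
    ext w
    exact h.permMap_mul σ τ w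

theorem permHom_apply (h : IsRootFrame Q u a) (σ : Equiv.Perm ι) (w : V) :
    h.permHom σ w = permMap Q u σ w := rfl

theorem map_sub_eq_one (h : IsRootFrame Q u a) {i j : ι} (hij : i ≠ j) : Q (u i - u j) = 1 := by
  refine eq_one_of_polar_self Q _ ?_
  rw [h.polar_sub_sub, if_pos rfl, if_neg hij, if_neg hij.symm, if_pos rfl]
  decide

/-- Only the terms at `i` and `j` move, with opposite displacements, and they combine into `-(u i -
u j, w) (u i - u j)`. -/
theorem permHom_swap_mem (h : IsRootFrame Q u a) {i j : ι} (hij : i ≠ j) :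
    h.permHom (Equiv.swap i j) ∈ reflections Q 1 := by
  have h1 := h.map_sub_eq_one hij
  have h0 : Q (u i - u j) ≠ 0 := by rw [h1]; decide
  refine ⟨u i - u j, h0, by simpa using h1, ?_⟩
  ext w
  rw [h.permHom_apply, orthReflection_apply_of_eq_one h0 h1, permMap_apply, sub_eq_add_neg]
  congr 1
  rw [Fintype.sum_eq_add i j hij]
  · rw [Equiv.swap_apply_left, Equiv.swap_apply_right, polar_sub_left]
    module
  · rintro x ⟨hxi, hxj⟩
    rw [Equiv.swap_apply_of_ne_of_ne hxi hxj, sub_self, smul_zero]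

theorem permHom_mem (h : IsRootFrame Q u a) (σ : Equiv.Perm ι) :
    h.permHom σ ∈ reflectionGroup Q 1 := by
  induction σ using Equiv.Perm.swap_induction_on with
  | one => rw [map_one]; exact one_mem _
  | swap_mul f x y hxy ih =>
    rw [map_mul]
    exact mul_mem (Subgroup.subset_closure (h.permHom_swap_mem hxy)) ih

/-- A permutation that acts on a root frame with at least five members as a scalar is trivial. -/
theorem eq_one_of_permHom_mem_scalars (h : IsRootFrame Q u a) (hι : 5 ≤ Fintype.card ι)
    {σ : Equiv.Perm ι} (hσ : h.permHom σ ∈ scalars V) : σ = 1 := by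
  obtain ⟨c, hc⟩ := hσ
  by_contra hne
  obtain ⟨i, hi⟩ : ∃ i, σ i ≠ i := by
    by_contra! hall
    exact hne (Equiv.ext hall)
  obtain ⟨j, hj⟩ : ∃ j, j ∉ ({i, σ⁻¹ i} : Finset ι) := by
    by_contra! hall
    have := Finset.card_le_card (fun x _ => hall x : Finset.univ ⊆ ({i, σ⁻¹ i} : Finset ι))
    have h2 : ({i, σ⁻¹ i} : Finset ι).card ≤ 2 := Finset.card_le_two
    rw [Finset.card_univ] at this
    omega
  -- The fifth index: `u i - u q` pairs to `1` with `u i - u j` but to `0` with its image, forcing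
  -- `c = 0`.
  obtain ⟨q, hq⟩ : ∃ q, q ∉ ({i, j, σ i, σ j} : Finset ι) := by
    by_contra! hall
    have := Finset.card_le_card (fun x _ => hall x : Finset.univ ⊆ ({i, j, σ i, σ j} : Finset ι))
    have h2 : ({i, j, σ i, σ j} : Finset ι).card ≤ 4 := Finset.card_le_four
    rw [Finset.card_univ] at this
    omega
  simp only [Finset.mem_insert, Finset.mem_singleton, not_or] at hj hq
  have hji : i ≠ σ j := fun e => hj.2 (Equiv.Perm.eq_inv_iff_eq.2 e.symm)
  have hcij := congrArg (polar Q (u i - u q)) (hc (u i - u j))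
  rw [h.permHom_apply, h.permMap_sub, Units.smul_def, polar_smul_right, h.polar_sub_sub,
    h.polar_sub_sub, if_neg (Ne.symm hi), if_neg hji, if_neg hq.2.2.1, if_neg hq.2.2.2, if_pos rfl,
    if_neg (Ne.symm hj.1), if_neg hq.1, if_neg hq.2.1] at hcij
  simp only [sub_zero, add_zero, smul_eq_mul, mul_one] at hcij
  exact c.ne_zero hcij.symm

theorem card_mem_symmetricDegrees (h : IsRootFrame Q u a) (hι : 5 ≤ Fintype.card ι) :
    Fintype.card ι ∈ symmetricDegrees (projReflections Q 1) := by
  let F : Equiv.Perm ι →* ProjReflectionGroup Q 1 :=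
    (QuotientGroup.mk' _).comp (h.permHom.codRestrict _ h.permHom_mem)
  have hF : Function.Injective F := by
    rw [injective_iff_map_eq_one]
    intro σ hσ
    refine h.eq_one_of_permHom_mem_scalars hι ?_
    have := (QuotientGroup.eq_one_iff _).1 hσ
    exact this
  let e := Fintype.equivFin ι
  refine ⟨F.comp e.symm.permCongrHom.toMonoidHom, hF.comp e.symm.permCongrHom.injective, ?_⟩
  intro i j hij
  have hs : e.symm.permCongrHom (Equiv.swap i j) = Equiv.swap (e.symm i) (e.symm j) := by
    ext x
    simp [Equiv.permCongrHom, Equiv.swap_apply_def, Equiv.eq_symm_apply, apply_ite e.symm]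
  refine ⟨h.permHom.codRestrict _ h.permHom_mem (Equiv.swap (e.symm i) (e.symm j)), ?_, ?_⟩
  · exact h.permHom_swap_mem (e.symm.injective.ne hij)
  · exact congrArg F hs

end IsRootFrame

/-- An orthogonal space of dimension `n` and discriminant `-1` has a root frame of every size
`r + 3` with `3 ∣ r` and `r < n`. -/
theorem exists_isRootFrame {n r : ℕ} (hQ : IsOrthogonalSpace Q n (-1)) (hr : r % 3 = 0)
    (hrn : r < n) : ∃ (u : Fin r ⊕ Fin 3 → V) (a : Fin r ⊕ Fin 3 → ZMod 3), IsRootFrame Q u a := by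
  obtain ⟨v, i₀, hv⟩ := exists_orthogonal_frame hQ
  -- Room for `r` vectors of norm `1` away from the vector of norm `-1`.
  have hcard : Fintype.card (Fin r) ≤ Fintype.card {i : Fin n // i ≠ i₀} := by
    rw [Fintype.card_subtype_compl]
    simp
    omega
  obtain ⟨f⟩ := Function.Embedding.nonempty_of_card_le hcard
  let y : Fin r → V := fun i => v (f i)
  have hy : ∀ i j, polar Q (y i) (y j) = if i = j then 1 else 0 := by
    intro i j
    simp only [y, hv, if_neg (f i).2, Subtype.coe_inj, f.injective.eq_iff]
  have hyz : ∀ i, polar Q (y i) (v i₀) = 0 := fun i => by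
    simp only [y, hv, if_neg (f i).2]
  have hzz : polar Q (v i₀) (v i₀) = -1 := by rw [hv, if_pos rfl, if_pos rfl]
  generalize v i₀ = z at hyz hzz
  have hr0 : (r : ZMod 3) = 0 := (ZMod.natCast_eq_zero_iff r 3).2 (Nat.dvd_of_mod_eq_zero hr)
  obtain ⟨s, hs⟩ : ∃ s, s = ∑ i, y i := ⟨_, rfl⟩
  have hys : ∀ i, polar Q (y i) s = 1 := fun i => by
    rw [hs, polar_sum_right]
    simp [hy]
  have hss : polar Q s s = 0 := by
    nth_rewrite 1 [hs]
    rw [polar_sum_left]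
    simp [hys, hr0]
  have hsz : polar Q s z = 0 := by
    rw [hs, polar_sum_left]
    simp [hyz]
  have hsy : ∀ i, polar Q s (y i) = 1 := fun i => by rw [polar_comm, hys]
  have hzy : ∀ i, polar Q z (y i) = 0 := fun i => by rw [polar_comm, hyz]
  have hzs : polar Q z s = 0 := by rw [polar_comm, hsz]
  -- As `3 ∣ r`, `s` is isotropic, and it pairs to `1` with every `y i`. The three extra vectors sum
  -- to `-s`, cancelling the `y i`; their offsets are their products with the `y i`.
  refine ⟨Sum.elim y ![s, z - s, -z - s], Sum.elim 0 ![1, -1, -1], ?_, ?_⟩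
  · rintro (i | i) (j | j)
    · simp [hy]
    · fin_cases j <;>
        simp [polar_sub_right, polar_neg_right, hys, hyz]
    · fin_cases i <;>
        simp [polar_sub_left, polar_neg_left, hsy, hzy]
    · fin_cases i <;> fin_cases j <;>
        simp [polar_sub_left, polar_neg_left, polar_sub_right, polar_neg_right,
          hss, hsz, hzs, hzz, -polar_self] <;> decide
  · rw [Fintype.sum_sum_type]
    simp only [Sum.elim_inl, Sum.elim_inr, ← hs, Fin.sum_univ_three]
    simp only [Matrix.cons_val]
    abel

end Lower

end ThreeTransposition

/-! ### Transport to `G` and the three residue classes -/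

theorem mainTheorem6 {V : Type*} [AddCommGroup V] [Module (ZMod 3) V]
    (Q : QuadraticForm (ZMod 3) V) (n : ℕ) (hn : 4 ≤ n)
    (hQ : ThreeTransposition.IsOrthogonalSpace Q n (-1))
    {G : Type*} [Group G] (D : Set G)
    (e : G ≃* ThreeTransposition.ProjReflectionGroup Q 1)
    (hD : e '' D = ThreeTransposition.projReflections Q 1) :
    (n % 3 = 0 → IsGreatest (ThreeTransposition.symmetricDegrees D) n) ∧
    (n % 3 = 2 → IsGreatest (ThreeTransposition.symmetricDegrees D) (n + 1)) ∧
    (n % 3 = 1 → IsGreatest (ThreeTransposition.symmetricDegrees D) (n + 2)) := by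
  have hsd : ThreeTransposition.symmetricDegrees D =
      ThreeTransposition.symmetricDegrees (ThreeTransposition.projReflections Q 1) := by
    ext k
    constructor
    · rintro ⟨f, hf, hfD⟩
      refine ⟨e.toMonoidHom.comp f, e.injective.comp hf, fun i j hij => ?_⟩
      rw [← hD]
      exact ⟨_, hfD i j hij, rfl⟩
    · rintro ⟨f, hf, hfD⟩
      refine ⟨e.symm.toMonoidHom.comp f, e.symm.injective.comp hf, fun i j hij => ?_⟩
      have hmem := hfD i j hij
      rw [← hD] at hmem
      obtain ⟨d, hd, hde⟩ := hmem
      change e.symm (f (Equiv.swap i j)) ∈ D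
      rwa [← hde, e.symm_apply_apply]
  have key : ∀ k, k % 3 = 0 → n ≤ k → k ≤ n + 2 →
      IsGreatest (ThreeTransposition.symmetricDegrees D) k := by
    intro k hk hnk hkn
    rw [hsd]
    refine ⟨?_, fun l hl => ThreeTransposition.le_of_mem_symmetricDegrees (by omega) hQ hk hnk hl⟩
    -- `k ≤ n + 2` is exactly `k - 3 < n`; being a multiple of 3 and at least 4, `k` also meets the
    -- bound of five.
    obtain ⟨u, a, h⟩ := ThreeTransposition.exists_isRootFrame (r := k - 3) hQ (by omega) (by omega)
    have hc : Fintype.card (Fin (k - 3) ⊕ Fin 3) = k := by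
      rw [Fintype.card_sum, Fintype.card_fin, Fintype.card_fin]; omega
    have := h.card_mem_symmetricDegrees (by omega)
    rwa [hc] at this
  exact ⟨fun h => key n h le_rfl (by omega), fun h => key (n + 1) (by omega) (by omega) (by omega),
    fun h => key (n + 2) (by omega) (by omega) le_rfl⟩
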